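/- Let $(\omega_1,\omega_2)$ be an $\mathbb R$-basis of $\mathbb C$, let $\wp$ be the Weierstrass function of the lattice $\mathbb Z\omega_1+\mathbb Z\omega_2$, and put $$e_1=\wp(\omega_1/2),\quad e_2=\wp(\omega_2/2),\quad e_3=\wp((\omega_1+\omega_2)/2),\quad \lambda=\frac{e_3-e_2}{e_1-e_2}.$$ A *horizontal geodesic* of a meromorphic quadratic differential $\omega$ on the Riemann sphere $\hat{\mathbb C}$ is a curve $\gamma$ on an open interval that avoids the critical points (zeros and poles) of $\omega$ and satisfies $f(\gamma(t))\,\gamma'(t)^2>0$ for all $t$, where $\omega=f(z)\,dz^2$ in a local coordinate $z$. A *trajectory* is a maximal horizontal geodesic, considered as a subset of $\hat{\mathbb C}$. It is *closed* if it is traversed by a periodic horizontal geodesic defined on $\mathbb R$, *critical* if it is traversed by a horizontal geodesic on a bounded open interval that tends to a critical point of $\omega$ at each of the two ends, and *recurrent* if it is neither closed nor critical. The differential $\omega$ is *Jenkins–Strebel* if it has no recurrent trajectories. **Theorem.** Let $\mu\in\mathbb C\setminus\{0,1\}$, let $\tau\in\mathbb C\setminus\mathbb R$, and let $(\omega_1,\omega_2)$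 be one of the two ordered bases $(\tau,1)$ and $(1,\tau)$ of the lattice $\mathbb Z+\mathbb Z\tau$, with $e_1,e_2,e_3,\lambda$ formed from it. Suppose that $\lambda=\mu$. Let $a\in\mathbb C$, $a\neq 0$. Then the quadratic differential $$\frac{a}{z(z-1)(z-\mu)}\,dz^2$$ on $\hat{\mathbb C}$, which has simple poles at $0,1,\mu,\infty$ and no other critical points, is Jenkins–Strebel if and only if $$a=\frac{k}{(1+q\tau)^2(e_1-e_2)}\ \text{ for some } q\in\mathbb Q \text{ and some real } k>0,\qquad\text{or}\qquad a=\frac{k}{\tau^2(e_1-e_2)}\ \text{ for some real } k>0 .$$ -/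

import Mathlib

open Filter Topology

noncomputable section

/-! ### Meromorphic quadratic differentials on the Riemann sphere -/

/-- The Riemann sphere `ℂ ∪ {∞}`. -/
abbrev RiemannSphere : Type := OnePoint ℂ

namespace RiemannSphere

/-- The coordinate `z`, a chart on the sphere minus `∞` (the value at `∞` is a dummy). -/
def coordZ (p : RiemannSphere) : ℂ := OnePoint.elim p 0 (fun z => z)

/-- The coordinate `u = 1/z`, a chart on the sphere minus `0` (the value at `0` is a dummy). -/
def coordU (p : RiemannSphere) : ℂ := OnePoint.elim p 0 (fun z => z⁻¹)

end RiemannSphere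

/-- A meromorphic quadratic differential on the Riemann sphere, given by its local expressions
`f(z) dz²` and `g(u) du²` in the two coordinates `z` and `u = 1/z`. On the overlap
`dz² = u⁻⁴ du²`. The coefficients are in normal form: they have their true value at each point
where they are holomorphic (and the value `0` at poles). -/
structure QuadraticDifferential where
  /-- the coefficient of `dz²` -/
  coeffZ : ℂ → ℂ
  /-- the coefficient of `du²`, `u = 1/z` -/
  coeffU : ℂ → ℂ
  meromorphicZ : MeromorphicNFOn coeffZ Set.univ
  meromorphicU : MeromorphicNFOn coeffU Set.univ
  compat : ∀ u : ℂ, u ≠ 0 → coeffU u = coeffZ u⁻¹ / u ^ 4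

namespace QuadraticDifferential

/-- The order of the quadratic differential at a point: positive at zeros, negative at poles. -/
def orderAt (ω : QuadraticDifferential) (p : RiemannSphere) : WithTop ℤ :=
  OnePoint.elim p (meromorphicOrderAt ω.coeffU 0) (fun z => meromorphicOrderAt ω.coeffZ z)

/-- The critical points are the zeros and the poles. -/
def IsCriticalPoint (ω : QuadraticDifferential) (p : RiemannSphere) : Prop :=
  ω.orderAt p ≠ 0

/-- At time `t` the curve `γ` is at a point that is not critical, is differentiable in a local
coordinate there, and `f(γ(t)) γ'(t)² > 0`, where `f` is the coefficient of the differential in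
that coordinate (`z` at finite points, `u = 1/z` at `∞`). -/
def IsHorizontalAt (ω : QuadraticDifferential) (γ : ℝ → RiemannSphere) (t : ℝ) : Prop :=
  ¬ ω.IsCriticalPoint (γ t) ∧
  (γ t ≠ OnePoint.infty → ∃ v : ℂ, HasDerivAt (fun s => RiemannSphere.coordZ (γ s)) v t ∧
    ∃ r : ℝ, 0 < r ∧ ω.coeffZ (RiemannSphere.coordZ (γ t)) * v ^ 2 = (r : ℂ)) ∧
  (γ t = OnePoint.infty → ∃ v : ℂ, HasDerivAt (fun s => RiemannSphere.coordU (γ s)) v t ∧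
    ∃ r : ℝ, 0 < r ∧ ω.coeffU (RiemannSphere.coordU (γ t)) * v ^ 2 = (r : ℂ))

/-- `γ`, restricted to the open interval `I`, is a horizontal geodesic of `ω`. -/
structure IsHorizontalGeodesic (ω : QuadraticDifferential) (γ : ℝ → RiemannSphere)
    (I : Set ℝ) : Prop where
  isOpen : IsOpen I
  ordConnected : I.OrdConnected
  nonempty : I.Nonempty
  continuousOn : ContinuousOn γ I
  horizontal : ∀ t ∈ I, ω.IsHorizontalAt γ t

/-- `T` is the set of points traversed by some horizontal geodesic. -/
def IsHorizontalArc (ω : QuadraticDifferential) (T : Set RiemannSphere) : Prop :=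
  ∃ (γ : ℝ → RiemannSphere) (I : Set ℝ), ω.IsHorizontalGeodesic γ I ∧ T = γ '' I

/-- A (horizontal) trajectory is a maximal horizontal geodesic, regarded as a subset of the
sphere: it is not contained in a longer one. -/
def IsTrajectory (ω : QuadraticDifferential) (T : Set RiemannSphere) : Prop :=
  Maximal ω.IsHorizontalArc T

/-- `T` is a closed horizontal curve: it is traversed by a periodic horizontal geodesic. -/
def IsClosedCurve (ω : QuadraticDifferential) (T : Set RiemannSphere) : Prop :=
  ∃ (γ : ℝ → RiemannSphere) (ℓ : ℝ), 0 < ℓ ∧ Function.Periodic γ ℓ ∧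
    ω.IsHorizontalGeodesic γ Set.univ ∧ T = Set.range γ

/-- `T` connects two critical points: it is traversed by a horizontal geodesic on a bounded open
interval that tends to critical points of `ω` at both ends. -/
def ConnectsCriticalPoints (ω : QuadraticDifferential) (T : Set RiemannSphere) : Prop :=
  ∃ (γ : ℝ → RiemannSphere) (s t : ℝ) (p q : RiemannSphere), s < t ∧
    ω.IsHorizontalGeodesic γ (Set.Ioo s t) ∧ T = γ '' Set.Ioo s t ∧
    ω.IsCriticalPoint p ∧ ω.IsCriticalPoint q ∧
    Tendsto γ (𝓝[>] s) (𝓝 p) ∧ Tendsto γ (𝓝[<] t) (𝓝 q)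

/-- A recurrent trajectory is one that is neither closed nor critical. -/
def IsRecurrentTrajectory (ω : QuadraticDifferential) (T : Set RiemannSphere) : Prop :=
  ω.IsTrajectory T ∧ ¬ ω.IsClosedCurve T ∧ ¬ ω.ConnectsCriticalPoints T

/-- A Jenkins–Strebel differential is one that has no recurrent trajectories. -/
def IsJenkinsStrebel (ω : QuadraticDifferential) : Prop :=
  ∀ T : Set RiemannSphere, ¬ ω.IsRecurrentTrajectory T

/-- The quadratic differential `a / (z (z - 1) (z - μ)) dz²` on the Riemann sphere. In the
coordinate `u = 1/z` it is `a / (u (1 - u) (1 - μ u)) du²`. -/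
def fourPole (μ a : ℂ) : QuadraticDifferential where
  coeffZ z := a / (z * (z - 1) * (z - μ))
  coeffU u := a / (u * (1 - u) * (1 - μ * u))
  meromorphicZ := by
    intro z _
    have h : AnalyticAt ℂ (fun z : ℂ => z * (z - 1) * (z - μ)) z := by fun_prop
    rcases eq_or_ne a 0 with rfl | ha
    · simpa using (analyticAt_const (v := (0 : ℂ)) (x := z)).meromorphicNFAt
    · exact (meromorphicNFAt_mul_iff_right (analyticAt_const (v := a)) ha).2
        h.meromorphicNFAt.inv
  meromorphicU := by
    intro u _
    have h : AnalyticAt ℂ (fun u : ℂ => u * (1 - u) * (1 - μ * u)) u := by fun_prop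
    rcases eq_or_ne a 0 with rfl | ha
    · simpa using (analyticAt_const (v := (0 : ℂ)) (x := u)).meromorphicNFAt
    · exact (meromorphicNFAt_mul_iff_right (analyticAt_const (v := a)) ha).2
        h.meromorphicNFAt.inv
  compat := by
    intro u hu
    have h1 : u⁻¹ * (u⁻¹ - 1) * (u⁻¹ - μ) * u ^ 4 = u * (1 - u) * (1 - μ * u) := by
      field_simp
    rw [div_div, h1]

end QuadraticDifferential

/-! ### Branch values of the Weierstrass function and the modular lambda function -/

namespace PeriodPair

/-- `e₁ = ℘(ω₁ / 2)`. -/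
def e₁ (L : PeriodPair) : ℂ := L.weierstrassP (L.ω₁ / 2)

/-- `e₂ = ℘(ω₂ / 2)`. -/
def e₂ (L : PeriodPair) : ℂ := L.weierstrassP (L.ω₂ / 2)

/-- `e₃ = ℘((ω₁ + ω₂) / 2)`. -/
def e₃ (L : PeriodPair) : ℂ := L.weierstrassP ((L.ω₁ + L.ω₂) / 2)

/-- The modular lambda function `(e₃ - e₂) / (e₁ - e₂)` of a lattice with an ordered basis. -/
def modularLambda (L : PeriodPair) : ℂ := (L.e₃ - L.e₂) / (L.e₁ - L.e₂)

end PeriodPair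

end

/-! The normalized function z = (℘ - e₂)/(e₁ - e₂) exhibits the sphere as the quotient of ℂ by the
lattice Λ and the sign w ↦ -w. Since ℘'² = 4(℘ - e₁)(℘ - e₂)(℘ - e₃), the differential pulls back to
the constant 4a(e₁ - e₂) dw² (`deriv_normalizedP_sq`), and its four poles are the images of the half
periods. Horizontal geodesics are therefore images of paths in straight lines of direction θ, where
a(e₁ - e₂)θ² > 0, that avoid ½Λ (`isHorizontalGeodesic_line`, `exists_global_lift`).

If θ can be chosen in Λ, a line missing ½Λ has a closed image, and a line meeting ½Λ is cut by it
into bounded segments, whose images are critical (`isJenkinsStrebel_of_mem_lattice`). If no nonzero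
real multiple of θ lies in Λ, a line missing ½Λ maps injectively, so its image is not closed. By
pigeonhole the line returns near its starting point at arbitrarily large times, so its image cannot
run into poles at both ends (`not_isJenkinsStrebel`).

Hence the condition is that a(e₁ - e₂)v² > 0 for some period v = m + nτ. Only the real line through
v matters: dividing by m gives the slope q = n/m, and m = 0 gives the second alternative. -/

namespace PeriodPair

/-! ### Values and fibres of the Weierstrass function -/

variable (L : PeriodPair)

lemma tendsto_weierstrassP_cobounded {l : ℂ} (hl : l ∈ L.lattice) :
    Tendsto L.weierstrassP (𝓝[≠] l) (Bornology.cobounded ℂ) := by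
  rw [tendsto_cobounded_iff_meromorphicOrderAt_neg (L.meromorphic_weierstrassP l),
    L.order_weierstrassP l hl]
  decide

/-- `℘` takes every finite value, by Liouville's theorem. -/
lemma exists_weierstrassP_eq (c : ℂ) : ∃ w ∉ L.lattice, L.weierstrassP w = c := by
  classical
  by_contra! hc
  -- Poles of ℘ become zeros of the reciprocal, so the value 0 makes `f` entire. Being periodic it
  -- is bounded, hence constant, although it vanishes only on the lattice.
  let f : ℂ → ℂ := fun z => if z ∈ L.lattice then 0 else (L.weierstrassP z - c)⁻¹
  have hoff : ∀ z ∉ L.lattice, DifferentiableAt ℂ f z := by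
    intro z hz
    have h : DifferentiableAt ℂ (fun z => (L.weierstrassP z - c)⁻¹) z :=
      ((L.analyticOnNhd_weierstrassP z hz).differentiableAt.sub_const c).inv
        (sub_ne_zero.2 (hc z hz))
    refine h.congr_of_eventuallyEq ?_
    filter_upwards [L.isClosed_lattice.isOpen_compl.mem_nhds hz] with y hy
    exact if_neg hy
  have hpunct : ∀ l ∈ L.lattice, ∀ᶠ z in 𝓝[≠] l, z ∉ L.lattice := by
    intro l hl
    filter_upwards [nhdsWithin_le_nhds (L.compl_lattice_sdiff_singleton_mem_nhds l),
      self_mem_nhdsWithin] with z hz hne hz'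
    exact hz ⟨hz', hne⟩
  have hdiff : Differentiable ℂ f := by
    intro z
    by_cases hz : z ∈ L.lattice
    · refine (Complex.analyticAt_of_differentiable_on_punctured_nhds_of_continuousAt
        ((hpunct z hz).mono hoff) ?_).differentiableAt
      rw [continuousAt_iff_punctured_nhds]
      have h0 : Tendsto (fun y => (L.weierstrassP y - c)⁻¹) (𝓝[≠] z) (𝓝 0) := by
        refine tendsto_inv₀_cobounded.comp ?_
        exact (tendsto_sub_const_cobounded c).comp (L.tendsto_weierstrassP_cobounded hz)
      rw [show f z = 0 from if_pos hz]
      refine h0.congr' ?_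
      filter_upwards [hpunct z hz] with y hy
      exact (if_neg hy).symm
    · exact hoff z hz
  have hper : ∀ z w, w ∈ L.lattice → f (z + w) = f z := by
    intro z w hw
    lift w to L.lattice using hw
    simp only [f, L.weierstrassP_add_coe, Submodule.add_mem_iff_left _ w.2]
  have hbdd := (IsZLattice.isCompact_range_of_periodic L.lattice f hdiff.continuous hper).isBounded
  have := hdiff.apply_eq_apply_of_bounded hbdd (L.ω₁ / 2) 0
  simp only [f, L.ω₁_div_two_notMem_lattice, if_false, zero_mem, if_true, inv_eq_zero,
    sub_eq_zero] at this
  exact hc _ L.ω₁_div_two_notMem_lattice this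

lemma isPreconnected_compl_of_countable {s : Set ℂ} (hs : s.Countable) : IsPreconnected sᶜ :=
  (hs.isConnected_compl_of_one_lt_rank (by simp)).isPreconnected

lemma countable_lattice : (L.lattice : Set ℂ).Countable :=
  Set.countable_coe_iff.1 (inferInstanceAs (Countable L.lattice))

lemma not_eventuallyConst_weierstrassP {w : ℂ} (hw : w ∉ L.lattice) (c : ℂ) :
    ¬ L.weierstrassP =ᶠ[𝓝 w] fun _ => c := by
  intro h
  have heq := L.analyticOnNhd_weierstrassP.eqOn_of_preconnected_of_eventuallyEq
    (g := fun _ => c) (fun _ _ => analyticAt_const)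
    (isPreconnected_compl_of_countable L.countable_lattice) hw h
  obtain ⟨z, hz, hzc⟩ := L.exists_weierstrassP_eq (c + 1)
  have := heq hz
  simp [hzc] at this

/-- `℘'' = 6 ℘² - g₂ / 2`. -/
lemma deriv_derivWeierstrassP {w : ℂ} (hw : w ∉ L.lattice) :
    deriv L.derivWeierstrassP w = 6 * L.weierstrassP w ^ 2 - L.g₂ / 2 := by
  have hU := L.isClosed_lattice.isOpen_compl
  have hd : ∀ z ∉ L.lattice, HasDerivAt L.weierstrassP (L.derivWeierstrassP z) z := fun z hz => by
    have := (L.analyticOnNhd_weierstrassP z hz).differentiableAt.hasDerivAt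
    rwa [L.deriv_weierstrassP] at this
  have hd' : ∀ z ∉ L.lattice, HasDerivAt L.derivWeierstrassP (deriv L.derivWeierstrassP z) z :=
    fun z hz => (L.analyticOnNhd_derivWeierstrassP z hz).differentiableAt.hasDerivAt
  -- Differentiating the cubic equation gives the claim only after multiplication by ℘'. This factor
  -- cancels because ℘ is not locally constant, so zeros of ℘' are isolated.
  have key : ∀ z ∉ L.lattice, L.derivWeierstrassP z *
      (deriv L.derivWeierstrassP z - (6 * L.weierstrassP z ^ 2 - L.g₂ / 2)) = 0 := by
    intro z hz
    have h1 := (hd' z hz).pow 2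
    have h2 := ((((hd z hz).pow 3).const_mul 4).sub ((hd z hz).const_mul L.g₂)).sub_const L.g₃
    have h3 := h1.unique (h2.congr_of_eventuallyEq (by
      filter_upwards [hU.mem_nhds hz] with y hy
      simpa using L.derivWeierstrassP_sq y hy))
    push_cast at h3
    linear_combination h3 / 2
  have hA : AnalyticAt ℂ L.derivWeierstrassP w := L.analyticOnNhd_derivWeierstrassP w hw
  have hP : AnalyticAt ℂ L.weierstrassP w := L.analyticOnNhd_weierstrassP w hw
  have hB : AnalyticAt ℂ (fun z => deriv L.derivWeierstrassP z -
      (6 * L.weierstrassP z ^ 2 - L.g₂ / 2)) w :=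
    hA.deriv.sub ((analyticAt_const.mul (hP.pow 2)).sub analyticAt_const)
  rcases hA.eventually_eq_zero_or_eventually_ne_zero with h0 | h0
  · exfalso
    obtain ⟨r, hr, hball⟩ := Metric.eventually_nhds_iff_ball.1 (h0.and (hU.mem_nhds hw))
    refine L.not_eventuallyConst_weierstrassP hw (L.weierstrassP w) ?_
    filter_upwards [Metric.ball_mem_nhds w hr] with y hy
    refine (convex_ball w r).is_const_of_fderivWithin_eq_zero (𝕜 := ℂ)
      (fun z hz => (hd z (hball z hz).2).differentiableAt.differentiableWithinAt) ?_ hy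
      (Metric.mem_ball_self hr)
    intro z hz
    rw [fderivWithin_of_isOpen Metric.isOpen_ball hz]
    ext
    simp [(hd z (hball z hz).2).hasFDerivAt.fderiv, (hball z hz).1]
  · rcases hB.eventually_eq_zero_or_eventually_ne_zero with h1 | h1
    · exact sub_eq_zero.1 h1.self_of_nhds
    · exfalso
      have : ∀ᶠ z in 𝓝[≠] w, False := by
        filter_upwards [h0, h1, nhdsWithin_le_nhds (hU.mem_nhds hw)] with z h h' hz
        exact mul_ne_zero h h' (key z hz)
      exact (NeBot.ne inferInstance) (eventually_false_iff_eq_bot.1 this)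

/-- The translates ℘(u + z) and ℘(v + z) solve the same second order equation with the same initial
data, so they agree near z = 0 and, by the identity theorem, off their poles. The pole at z = -u
must then be common to both, which forces u - v into the lattice. -/
lemma sub_mem_lattice_of_weierstrassP_eq {u v : ℂ} (hu : u ∉ L.lattice) (hv : v ∉ L.lattice)
    (h : L.weierstrassP u = L.weierstrassP v)
    (h' : L.derivWeierstrassP u = L.derivWeierstrassP v) : u - v ∈ L.lattice := by
  by_contra hne
  have hA : ∀ c z : ℂ, c + z ∉ L.lattice →
      AnalyticAt ℂ (fun z => L.weierstrassP (c + z)) z := fun c z hz =>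
    AnalyticAt.fun_comp (f := fun z => c + z) (L.analyticOnNhd_weierstrassP _ hz) (by fun_prop)
  have hd : ∀ c z : ℂ, c + z ∉ L.lattice →
      HasDerivAt (fun z => L.weierstrassP (c + z)) (L.derivWeierstrassP (c + z)) z :=
    fun c z hz => by
      have := (L.analyticOnNhd_weierstrassP _ hz).differentiableAt.hasDerivAt
      rw [L.deriv_weierstrassP] at this
      exact this.comp_const_add c z
  have hd' : ∀ c z : ℂ, c + z ∉ L.lattice →
      HasDerivAt (fun z => L.derivWeierstrassP (c + z))
        (6 * L.weierstrassP (c + z) ^ 2 - L.g₂ / 2) z :=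
    fun c z hz => by
      have := (L.analyticOnNhd_derivWeierstrassP _ hz).differentiableAt.hasDerivAt
      rw [L.deriv_derivWeierstrassP hz] at this
      exact this.comp_const_add c z
  have hev : ∀ c ∉ L.lattice, ∀ᶠ z in 𝓝 (0 : ℂ), c + z ∉ L.lattice := fun c hc => by
    have : ContinuousAt (fun z : ℂ => c + z) 0 := by fun_prop
    exact this.eventually_mem (L.isClosed_lattice.isOpen_compl.mem_nhds (by simpa using hc))
  set d : ℂ → ℂ := fun z => L.weierstrassP (u + z) - L.weierstrassP (v + z) with hd_def
  have hdA : AnalyticAt ℂ d 0 := (hA u 0 (by simpa)).sub (hA v 0 (by simpa))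
  have e1 : deriv d =ᶠ[𝓝 0] fun z => L.derivWeierstrassP (u + z) - L.derivWeierstrassP (v + z) := by
    filter_upwards [hev u hu, hev v hv] with z hz hz'
    exact ((hd u z hz).sub (hd v z hz')).deriv
  have e2 : deriv (deriv d) =ᶠ[𝓝 0] fun z =>
      (6 * (L.weierstrassP (u + z) + L.weierstrassP (v + z))) * d z := by
    refine e1.deriv.trans ?_
    filter_upwards [hev u hu, hev v hv] with z hz hz'
    refine ((hd' u z hz).sub (hd' v z hz')).deriv.trans ?_
    rw [hd_def]
    ring
  have o1 := hdA.analyticOrderAt_deriv_add_one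
  have o2 := hdA.deriv.analyticOrderAt_deriv_add_one
  have hS : AnalyticAt ℂ (fun z => 6 * (L.weierstrassP (u + z) + L.weierstrassP (v + z))) 0 :=
    analyticAt_const.mul ((hA u 0 (by simpa)).add (hA v 0 (by simpa)))
  have o3 : analyticOrderAt (deriv (deriv d)) 0 = _ + analyticOrderAt d 0 :=
    (analyticOrderAt_congr e2).trans (analyticOrderAt_mul hS hdA)
  have z0 : d 0 = 0 := by simp [d, h]
  have z1 : deriv d 0 = 0 := by rw [e1.self_of_nhds]; simp [h']
  simp only [z0, z1, sub_zero] at o1 o2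
  -- Two derivatives lower a finite order of vanishing by 2, while d'' is an analytic multiple of d
  -- and so vanishes to at least the order of d.
  have htop : analyticOrderAt d 0 = ⊤ := by
    by_contra ht
    have hle : analyticOrderAt d 0 ≤ analyticOrderAt (deriv (deriv d)) 0 := by
      rw [o3]; exact le_add_self
    rw [← o1, ← o2] at hle ht
    generalize analyticOrderAt (deriv (deriv d)) 0 = n at hle ht
    induction n using ENat.recTopCoe with
    | top => simp at ht
    | coe n =>
      norm_cast at hle
      omega
  have hpre : IsPreconnected ((fun z => u + z) ⁻¹' (L.lattice : Set ℂ) ∪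
      (fun z => v + z) ⁻¹' (L.lattice : Set ℂ))ᶜ :=
    isPreconnected_compl_of_countable
      ((L.countable_lattice.preimage (add_right_injective u)).union
        (L.countable_lattice.preimage (add_right_injective v)))
  have hEq := AnalyticOnNhd.eqOn_of_preconnected_of_eventuallyEq
    (f := fun z => L.weierstrassP (u + z)) (g := fun z => L.weierstrassP (v + z)) (𝕜 := ℂ)
    (fun z hz => hA u z fun hm => by exact hz (Or.inl hm))
    (fun z hz => hA v z fun hm => by exact hz (Or.inr hm)) hpre (z₀ := 0) (by simp [hu, hv])
    ((analyticOrderAt_eq_top.1 htop).mono fun z hz => sub_eq_zero.1 hz)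
  have hvu : v + -u ∉ L.lattice := fun hm => hne (by
    have := neg_mem hm
    rwa [neg_add, neg_neg, add_comm, ← sub_eq_add_neg] at this)
  have ht1 : Tendsto (fun z => L.weierstrassP (u + z)) (𝓝[≠] (-u)) (Bornology.cobounded ℂ) := by
    refine (L.tendsto_weierstrassP_cobounded (zero_mem _)).comp ?_
    refine tendsto_nhdsWithin_iff.2 ⟨?_, ?_⟩
    · have : ContinuousAt (fun z : ℂ => u + z) (-u) := by fun_prop
      simpa [ContinuousAt] using this.mono_left nhdsWithin_le_nhds
    · filter_upwards [self_mem_nhdsWithin] with z hz h0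
      exact hz (eq_neg_of_add_eq_zero_right h0)
  have ht2 : Tendsto (fun z => L.weierstrassP (v + z)) (𝓝[≠] (-u))
      (𝓝 (L.weierstrassP (v + -u))) :=
    (hA v (-u) hvu).continuousAt.tendsto.mono_left nhdsWithin_le_nhds
  have hcongr : (fun z => L.weierstrassP (u + z)) =ᶠ[𝓝[≠] (-u)]
      fun z => L.weierstrassP (v + z) := by
    have c1 : ∀ᶠ z in 𝓝[≠] (-u), u + z ∉ L.lattice := by
      have : ContinuousAt (fun z : ℂ => u + z) (-u) := by fun_prop
      filter_upwards [nhdsWithin_le_nhds (this.eventually_mem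
        (L.compl_lattice_sdiff_singleton_mem_nhds _)), self_mem_nhdsWithin] with z hz hz' hm
      exact hz ⟨hm, fun h0 => hz' (eq_neg_of_add_eq_zero_right (by simpa using h0))⟩
    have c2 : ∀ᶠ z in 𝓝[≠] (-u), v + z ∉ L.lattice := by
      have : ContinuousAt (fun z : ℂ => v + z) (-u) := by fun_prop
      exact nhdsWithin_le_nhds
        (this.eventually_mem (L.isClosed_lattice.isOpen_compl.mem_nhds hvu))
    filter_upwards [c1, c2] with z h1 h2
    exact hEq (by simp [h1, h2])
  exact not_tendsto_nhds_of_tendsto_atTop (tendsto_norm_cobounded_atTop.comp ht1) _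
    ((ht2.congr' hcongr.symm).norm)

/-- `℘` identifies two points only if they agree up to sign modulo the lattice. -/
lemma sub_mem_or_add_mem_of_weierstrassP_eq {u v : ℂ} (hu : u ∉ L.lattice) (hv : v ∉ L.lattice)
    (h : L.weierstrassP u = L.weierstrassP v) : u - v ∈ L.lattice ∨ u + v ∈ L.lattice := by
  have hsq : L.derivWeierstrassP u ^ 2 = L.derivWeierstrassP v ^ 2 := by
    rw [L.derivWeierstrassP_sq u hu, L.derivWeierstrassP_sq v hv, h]
  rcases sq_eq_sq_iff_eq_or_eq_neg.1 hsq with h' | h'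
  · exact Or.inl (L.sub_mem_lattice_of_weierstrassP_eq hu hv h h')
  · right
    have := L.sub_mem_lattice_of_weierstrassP_eq hu (v := -v) (by simpa using hv)
      (by simpa using h) (by simpa using h')
    simpa using this

end PeriodPair

/-! ### The quotient map from the plane to the sphere -/

namespace PeriodPair

variable (L : PeriodPair)

/-- The affine normalization of `℘` taking the values `1`, `0`, `λ` at the three half periods. -/
noncomputable def normalizedP (w : ℂ) : ℂ := (L.weierstrassP w - L.e₂) / (L.e₁ - L.e₂)

open Classical in
/-- The normalized `℘`-function as a map to the Riemann sphere. -/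
noncomputable def sphereMap (w : ℂ) : RiemannSphere :=
  if w ∈ L.lattice then OnePoint.infty else (L.normalizedP w : RiemannSphere)

variable {L}

lemma sphereMap_of_mem {w : ℂ} (hw : w ∈ L.lattice) : L.sphereMap w = OnePoint.infty := if_pos hw

lemma sphereMap_of_notMem {w : ℂ} (hw : w ∉ L.lattice) :
    L.sphereMap w = (L.normalizedP w : RiemannSphere) := if_neg hw

lemma two_mul_mem {w : ℂ} (hw : w ∈ L.lattice) : 2 * w ∈ L.lattice := by
  rw [two_mul]; exact add_mem hw hw

lemma half_sum_notMem_lattice : (L.ω₁ + L.ω₂) / 2 ∉ L.lattice := by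
  have := (L.mul_ω₁_add_mul_ω₂_mem_lattice (α := 1 / 2) (β := 1 / 2)).not.mpr (by norm_num)
  convert this using 2
  push_cast
  ring

lemma derivWeierstrassP_eq_zero_of_two_mul_mem {w : ℂ} (h : 2 * w ∈ L.lattice) :
    L.derivWeierstrassP w = 0 := by
  have := L.derivWeierstrassP_add_coe (-w) ⟨_, h⟩
  rw [show -w + 2 * w = w by ring, L.derivWeierstrassP_neg] at this
  linear_combination this / 2

/-- A vanishing denominator would give λ = 0 by the convention x / 0 = 0. -/
lemma e₁_ne_e₂ (h0 : L.modularLambda ≠ 0) : L.e₁ - L.e₂ ≠ 0 := by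
  intro h; simp [modularLambda, h] at h0

lemma e₃_ne_e₂ (h0 : L.modularLambda ≠ 0) : L.e₃ - L.e₂ ≠ 0 := by
  intro h; simp [modularLambda, h] at h0

lemma e₃_ne_e₁ (h0 : L.modularLambda ≠ 0) (h1 : L.modularLambda ≠ 1) : L.e₃ - L.e₁ ≠ 0 := by
  intro h
  apply h1
  rw [modularLambda, div_eq_one_iff_eq (e₁_ne_e₂ h0)]
  linear_combination h

/-- `℘'² = 4 (℘ - e₁) (℘ - e₂) (℘ - e₃)`. -/
lemma derivWeierstrassP_sq_eq_prod (h0 : L.modularLambda ≠ 0) (h1 : L.modularLambda ≠ 1)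
    {w : ℂ} (hw : w ∉ L.lattice) : L.derivWeierstrassP w ^ 2 =
      4 * (L.weierstrassP w - L.e₁) * (L.weierstrassP w - L.e₂) * (L.weierstrassP w - L.e₃) := by
  have root : ∀ z ∉ L.lattice, 2 * z ∈ L.lattice →
      4 * L.weierstrassP z ^ 3 - L.g₂ * L.weierstrassP z - L.g₃ = 0 := fun z hz hz' => by
    rw [← L.derivWeierstrassP_sq z hz, derivWeierstrassP_eq_zero_of_two_mul_mem hz']
    simp
  have r1 : 4 * L.e₁ ^ 3 - L.g₂ * L.e₁ - L.g₃ = 0 :=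
    root _ L.ω₁_div_two_notMem_lattice (by simpa [mul_div_cancel₀] using L.ω₁_mem_lattice)
  have r2 : 4 * L.e₂ ^ 3 - L.g₂ * L.e₂ - L.g₃ = 0 :=
    root _ L.ω₂_div_two_notMem_lattice (by simpa [mul_div_cancel₀] using L.ω₂_mem_lattice)
  have r3 : 4 * L.e₃ ^ 3 - L.g₂ * L.e₃ - L.g₃ = 0 :=
    root _ half_sum_notMem_lattice
      (by simpa [mul_div_cancel₀] using add_mem L.ω₁_mem_lattice L.ω₂_mem_lattice)
  -- Subtracting the cubic equations in pairs and cancelling the nonzero root differences yields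
  -- Vieta's relations.
  have s12 : 4 * (L.e₁ ^ 2 + L.e₁ * L.e₂ + L.e₂ ^ 2) = L.g₂ :=
    mul_left_cancel₀ (e₁_ne_e₂ h0) (by linear_combination r1 - r2)
  have s32 : 4 * (L.e₃ ^ 2 + L.e₃ * L.e₂ + L.e₂ ^ 2) = L.g₂ :=
    mul_left_cancel₀ (e₃_ne_e₂ h0) (by linear_combination r3 - r2)
  have s : L.e₁ + L.e₂ + L.e₃ = 0 :=
    mul_left_cancel₀ (e₃_ne_e₁ h0 h1) (by linear_combination (s32 - s12) / 4)
  have hg3 : L.g₃ = 4 * L.e₁ * L.e₂ * L.e₃ := by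
    linear_combination (-1) * r1 + L.e₁ * s12 - 4 * L.e₁ * L.e₂ * s
  rw [L.derivWeierstrassP_sq w hw]
  have e3 : L.e₃ = -L.e₁ - L.e₂ := by linear_combination s
  rw [hg3, ← s12, e3]
  ring

lemma normalizedP_sub_one (h0 : L.modularLambda ≠ 0) (w : ℂ) :
    L.normalizedP w - 1 = (L.weierstrassP w - L.e₁) / (L.e₁ - L.e₂) := by
  have := e₁_ne_e₂ h0
  rw [normalizedP]; field_simp; ring

lemma normalizedP_sub_lambda (w : ℂ) :
    L.normalizedP w - L.modularLambda = (L.weierstrassP w - L.e₃) / (L.e₁ - L.e₂) := by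
  rw [normalizedP, modularLambda]; ring

lemma hasDerivAt_normalizedP {w : ℂ} (hw : w ∉ L.lattice) :
    HasDerivAt L.normalizedP (L.derivWeierstrassP w / (L.e₁ - L.e₂)) w := by
  have := (L.analyticOnNhd_weierstrassP w hw).differentiableAt.hasDerivAt
  rw [L.deriv_weierstrassP] at this
  exact (this.sub_const _).div_const _

lemma analyticAt_normalizedP {w : ℂ} (hw : w ∉ L.lattice) : AnalyticAt ℂ L.normalizedP w := by
  have : AnalyticAt ℂ L.weierstrassP w := L.analyticOnNhd_weierstrassP w hw
  simpa only [normalizedP, div_eq_mul_inv] using! (this.sub analyticAt_const).mul analyticAt_const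

/-- This is what makes the pullback of the differential constant: the product on the right cancels
the denominator of its coefficient. -/
lemma deriv_normalizedP_sq (h0 : L.modularLambda ≠ 0) (h1 : L.modularLambda ≠ 1)
    {w : ℂ} (hw : w ∉ L.lattice) : (L.derivWeierstrassP w / (L.e₁ - L.e₂)) ^ 2 =
      4 * (L.e₁ - L.e₂) *
        (L.normalizedP w * (L.normalizedP w - 1) * (L.normalizedP w - L.modularLambda)) := by
  have := e₁_ne_e₂ h0
  rw [normalizedP_sub_one h0, normalizedP_sub_lambda, normalizedP, div_pow,
    derivWeierstrassP_sq_eq_prod h0 h1 hw]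
  field_simp

lemma normalizedP_prod_eq_zero_iff (h0 : L.modularLambda ≠ 0) (h1 : L.modularLambda ≠ 1)
    {w : ℂ} (hw : w ∉ L.lattice) :
    L.normalizedP w * (L.normalizedP w - 1) * (L.normalizedP w - L.modularLambda) = 0 ↔
      2 * w ∈ L.lattice := by
  have hne := e₁_ne_e₂ h0
  constructor
  · have key : ∀ v ∉ L.lattice, 2 * v ∈ L.lattice → L.weierstrassP w = L.weierstrassP v →
        2 * w ∈ L.lattice := fun v hv hv2 h => by
      rcases L.sub_mem_or_add_mem_of_weierstrassP_eq hw hv h with h | h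
      · have := add_mem (two_mul_mem h) hv2
        rwa [show 2 * (w - v) + 2 * v = 2 * w by ring] at this
      · have := sub_mem (two_mul_mem h) hv2
        rwa [show 2 * (w + v) - 2 * v = 2 * w by ring] at this
    rw [normalizedP_sub_one h0, normalizedP_sub_lambda, normalizedP]
    simp only [mul_eq_zero, div_eq_zero_iff, hne, or_false, sub_eq_zero]
    rintro ((h | h) | h)
    · exact key _ L.ω₂_div_two_notMem_lattice
        (by simpa [mul_div_cancel₀] using L.ω₂_mem_lattice) h
    · exact key _ L.ω₁_div_two_notMem_lattice
        (by simpa [mul_div_cancel₀] using L.ω₁_mem_lattice) h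
    · exact key _ half_sum_notMem_lattice
        (by simpa [mul_div_cancel₀] using add_mem L.ω₁_mem_lattice L.ω₂_mem_lattice) h
  · intro h
    have hd := deriv_normalizedP_sq h0 h1 hw
    rw [derivWeierstrassP_eq_zero_of_two_mul_mem h] at hd
    simpa [hne, or_assoc] using hd

lemma continuous_sphereMap (h0 : L.modularLambda ≠ 0) : Continuous L.sphereMap := by
  have hne := e₁_ne_e₂ h0
  rw [continuous_iff_continuousAt]
  intro w
  by_cases hw : w ∈ L.lattice
  · rw [continuousAt_iff_punctured_nhds, sphereMap_of_mem hw]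
    have h1 : Tendsto L.normalizedP (𝓝[≠] w) (Bornology.cobounded ℂ) := by
      have h2 := (tendsto_sub_const_cobounded L.e₂).comp (L.tendsto_weierstrassP_cobounded hw)
      rw [← tendsto_norm_atTop_iff_cobounded] at h2 ⊢
      simpa [Function.comp_def, normalizedP] using
        h2.atTop_div_const (norm_pos_iff.2 hne)
    have h3 : Tendsto (fun z => (L.normalizedP z : RiemannSphere)) (𝓝[≠] w)
        (𝓝 OnePoint.infty) := by
      refine OnePoint.tendsto_coe_infty.comp ?_
      rwa [coclosedCompact_eq_cocompact, ← Metric.cobounded_eq_cocompact]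
    refine h3.congr' ?_
    filter_upwards [nhdsWithin_le_nhds (L.compl_lattice_sdiff_singleton_mem_nhds w),
      self_mem_nhdsWithin] with z hz hne'
    exact (sphereMap_of_notMem fun hm => hz ⟨hm, hne'⟩).symm
  · have h1 : ContinuousAt (fun z => (L.normalizedP z : RiemannSphere)) w :=
      OnePoint.continuous_coe.continuousAt.comp (analyticAt_normalizedP hw).continuousAt
    refine h1.congr ?_
    filter_upwards [L.isClosed_lattice.isOpen_compl.mem_nhds hw] with z hz
    exact (sphereMap_of_notMem hz).symm

lemma sphereMap_surjective (h0 : L.modularLambda ≠ 0) : Function.Surjective L.sphereMap := by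
  intro p
  induction p using OnePoint.rec with
  | infty => exact ⟨0, sphereMap_of_mem (zero_mem _)⟩
  | coe z =>
    obtain ⟨w, hw, h⟩ := L.exists_weierstrassP_eq (z * (L.e₁ - L.e₂) + L.e₂)
    refine ⟨w, ?_⟩
    rw [sphereMap_of_notMem hw, normalizedP, h, add_sub_cancel_right,
      mul_div_cancel_right₀ _ (e₁_ne_e₂ h0)]

lemma sphereMap_add_mem (w : ℂ) {l : ℂ} (hl : l ∈ L.lattice) :
    L.sphereMap (w + l) = L.sphereMap w := by
  classical
  have h1 : w + l ∈ L.lattice ↔ w ∈ L.lattice := Submodule.add_mem_iff_left _ hl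
  have h2 : L.weierstrassP (w + l) = L.weierstrassP w := L.weierstrassP_add_coe w ⟨l, hl⟩
  simp only [sphereMap, normalizedP, h1, h2]

lemma sphereMap_neg (w : ℂ) : L.sphereMap (-w) = L.sphereMap w := by
  classical
  simp only [sphereMap, normalizedP, neg_mem_iff, L.weierstrassP_neg]

lemma sub_mem_or_add_mem_of_sphereMap_eq (h0 : L.modularLambda ≠ 0) {u v : ℂ}
    (h : L.sphereMap u = L.sphereMap v) :
    u - v ∈ L.lattice ∨ u + v ∈ L.lattice := by
  by_cases hu : u ∈ L.lattice <;> by_cases hv : v ∈ L.lattice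
  · exact Or.inl (sub_mem hu hv)
  · simp [sphereMap_of_mem hu, sphereMap_of_notMem hv] at h
  · simp [sphereMap_of_mem hv, sphereMap_of_notMem hu] at h
  · rw [sphereMap_of_notMem hu, sphereMap_of_notMem hv, OnePoint.coe_eq_coe, normalizedP,
      normalizedP, div_left_inj' (e₁_ne_e₂ h0), sub_left_inj] at h
    exact L.sub_mem_or_add_mem_of_weierstrassP_eq hu hv h

lemma isClosed_half_lattice : IsClosed {w : ℂ | 2 * w ∈ L.lattice} :=
  L.isClosed_lattice.preimage (continuous_const_mul 2)

/-- A coefficient in normal form has order zero exactly where its value is nonzero. Here it vanishes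
only through division by zero, that is, at the four branch points. -/
lemma isCriticalPoint_sphereMap (h0 : L.modularLambda ≠ 0) (h1 : L.modularLambda ≠ 1)
    {a : ℂ} (ha : a ≠ 0) (w : ℂ) :
    (QuadraticDifferential.fourPole L.modularLambda a).IsCriticalPoint (L.sphereMap w) ↔
      2 * w ∈ L.lattice := by
  set ω := QuadraticDifferential.fourPole L.modularLambda a
  by_cases hw : w ∈ L.lattice
  · simp only [sphereMap_of_mem hw, two_mul_mem hw, iff_true]
    refine ((ω.meromorphicU (Set.mem_univ 0)).meromorphicOrderAt_eq_zero_iff).not.2 ?_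
    simp [ω, QuadraticDifferential.fourPole]
  · rw [sphereMap_of_notMem hw, ← normalizedP_prod_eq_zero_iff h0 h1 hw]
    refine ((ω.meromorphicZ (Set.mem_univ _)).meromorphicOrderAt_eq_zero_iff).not.trans ?_
    simp only [ω, QuadraticDifferential.fourPole, ne_eq, not_not, div_eq_zero_iff, ha, false_or]

end PeriodPair

/-! ### Horizontal geodesics are images of straight lines -/

namespace PeriodPair

open QuadraticDifferential

variable {L : PeriodPair} {a θ : ℂ} {r : ℝ}

lemma isHorizontalAt_line (h0 : L.modularLambda ≠ 0) (h1 : L.modularLambda ≠ 1) (ha : a ≠ 0)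
    (hr : 0 < r) (hθ : a * (L.e₁ - L.e₂) * θ ^ 2 = r) (w : ℂ) {t : ℝ}
    (ht : 2 * (w + t * θ) ∉ L.lattice) :
    (fourPole L.modularLambda a).IsHorizontalAt (fun s => L.sphereMap (w + s * θ)) t := by
  have hw : w + t * θ ∉ L.lattice := fun h => ht (two_mul_mem h)
  refine ⟨(isCriticalPoint_sphereMap h0 h1 ha _).not.2 ht, fun _ => ?_, fun h => ?_⟩
  · have hline : HasDerivAt (fun s : ℝ => w + s * θ) θ t := by
      simpa using ((Complex.ofRealCLM.hasDerivAt (x := t)).mul_const θ).const_add w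
    have hev : ∀ᶠ s : ℝ in 𝓝 t, w + s * θ ∉ L.lattice :=
      hline.continuousAt.eventually_mem (L.isClosed_lattice.isOpen_compl.mem_nhds hw)
    have hd : HasDerivAt (fun s : ℝ => L.normalizedP (w + s * θ))
        (L.derivWeierstrassP (w + t * θ) / (L.e₁ - L.e₂) * θ) t :=
      HasDerivAt.comp (h₂ := L.normalizedP) t (hasDerivAt_normalizedP hw) hline
    refine ⟨_, hd.congr_of_eventuallyEq ?_, 4 * r, by positivity, ?_⟩
    · filter_upwards [hev] with s hs
      rw [sphereMap_of_notMem hs]; rfl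
    · have hne := (normalizedP_prod_eq_zero_iff h0 h1 hw).not.2 ht
      beta_reduce
      rw [sphereMap_of_notMem hw, mul_pow, deriv_normalizedP_sq h0 h1 hw]
      change a / (L.normalizedP _ * (L.normalizedP _ - 1) * (L.normalizedP _ - _)) * _ = _
      push_cast
      rw [← hθ]
      generalize L.normalizedP (w + t * θ) * _ * _ = p at hne
      have hne12 := e₁_ne_e₂ h0
      field_simp
  · simp [sphereMap_of_notMem hw] at h

lemma isHorizontalGeodesic_line (h0 : L.modularLambda ≠ 0) (h1 : L.modularLambda ≠ 1) (ha : a ≠ 0)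
    (hr : 0 < r) (hθ : a * (L.e₁ - L.e₂) * θ ^ 2 = r) (w : ℂ) {I : Set ℝ} (hI : IsOpen I)
    (hc : I.OrdConnected) (hne : I.Nonempty) (h : ∀ t ∈ I, 2 * (w + t * θ) ∉ L.lattice) :
    (fourPole L.modularLambda a).IsHorizontalGeodesic (fun s => L.sphereMap (w + s * θ)) I where
  isOpen := hI
  ordConnected := hc
  nonempty := hne
  continuousOn := ((continuous_sphereMap h0).comp (by fun_prop)).continuousOn
  horizontal t ht := isHorizontalAt_line h0 h1 ha hr hθ w (h t ht)

/-- Near any time, a horizontal geodesic is the image of a path running inside a straight line of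
direction `θ`. -/
lemma exists_local_lift (h0 : L.modularLambda ≠ 0) (h1 : L.modularLambda ≠ 1) (ha : a ≠ 0)
    (hr : 0 < r) (hθ : a * (L.e₁ - L.e₂) * θ ^ 2 = r) {γ : ℝ → RiemannSphere} {I : Set ℝ}
    (hγ : (fourPole L.modularLambda a).IsHorizontalGeodesic γ I) {t₀ : ℝ} (ht₀ : t₀ ∈ I)
    {w : ℂ} (hw : γ t₀ = L.sphereMap w) :
    ∃ σ : ℝ → ℝ, σ t₀ = 0 ∧ ContinuousAt σ t₀ ∧
      ∀ᶠ t in 𝓝 t₀, γ t = L.sphereMap (w + σ t * θ) := by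
  have hne := e₁_ne_e₂ h0
  have hθ0 : θ ≠ 0 := by
    rintro rfl
    exact hr.ne' (by simpa using hθ.symm)
  have hcrit : ∀ t ∈ I, ∀ v, γ t = L.sphereMap v → 2 * v ∉ L.lattice := fun t ht v hv => by
    have := (hγ.horizontal t ht).1
    rwa [hv, isCriticalPoint_sphereMap h0 h1 ha] at this
  have hw2 := hcrit t₀ ht₀ w hw
  have hwl : w ∉ L.lattice := fun h => hw2 (two_mul_mem h)
  have hfin : ∀ t ∈ I, γ t ≠ OnePoint.infty := fun t ht h =>
    hcrit t ht 0 (h.trans (sphereMap_of_mem (zero_mem _)).symm) (by simp)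
  have hcoe : ∀ t ∈ I, γ t = (RiemannSphere.coordZ (γ t) : RiemannSphere) := fun t ht => by
    obtain ⟨z, hz⟩ := OnePoint.ne_infty_iff_exists.1 (hfin t ht)
    rw [← hz]; rfl
  set z : ℝ → ℂ := fun t => RiemannSphere.coordZ (γ t) with hz_def
  have hz0 : z t₀ = L.normalizedP w := by
    rw [hz_def]
    simp only [hw, sphereMap_of_notMem hwl]
    rfl
  -- a local inverse of the normalized `℘`-function
  have hd0 : L.derivWeierstrassP w / (L.e₁ - L.e₂) ≠ 0 := by
    intro h
    have := deriv_normalizedP_sq h0 h1 hwl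
    rw [h] at this
    exact hw2 ((normalizedP_prod_eq_zero_iff h0 h1 hwl).1 (by simpa [hne] using this.symm))
  have hA := analyticAt_normalizedP hwl
  have hd1 : deriv L.normalizedP w ≠ 0 := by rwa [(hasDerivAt_normalizedP hwl).deriv]
  obtain ⟨g, hg, hgA, hgr⟩ : ∃ g : ℂ → ℂ, g (L.normalizedP w) = w ∧
      AnalyticAt ℂ g (L.normalizedP w) ∧ ∀ᶠ y in 𝓝 (L.normalizedP w), L.normalizedP (g y) = y :=
    ⟨hA.hasStrictDerivAt.localInverse _ _ _ hd1,
      HasStrictFDerivAt.localInverse_apply_image ..,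
      hA.analyticAt_localInverse hd1, HasStrictDerivAt.eventually_right_inverse ..⟩
  rw [← hz0] at hg hgA hgr
  have hzc : ∀ t ∈ I, ∃ v : ℂ, HasDerivAt z v t ∧ ∃ ρ : ℝ, 0 < ρ ∧
      a / (z t * (z t - 1) * (z t - L.modularLambda)) * v ^ 2 = (ρ : ℂ) := fun t ht =>
    (hγ.horizontal t ht).2.1 (hfin t ht)
  have hzcont : ContinuousAt z t₀ := (hzc t₀ ht₀).choose_spec.1.continuousAt
  have hWcont : ContinuousAt (fun t => g (z t)) t₀ :=
    ContinuousAt.comp (g := g) hgA.continuousAt hzcont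
  -- the lift is differentiable, with derivative a real multiple of `θ`
  have hlift : ∀ᶠ t in 𝓝 t₀, γ t = L.sphereMap (g (z t)) ∧
      ∃ x : ℝ, HasDerivAt (fun s => (g (z s) - w) / θ) (x : ℂ) t := by
    filter_upwards [hzcont.eventually hgA.eventually_analyticAt,
      (hzcont.eventually hgr).eventually_nhds,
      hWcont.eventually_mem (isClosed_half_lattice.isOpen_compl.mem_nhds (by rwa [hg])),
      hγ.isOpen.mem_nhds ht₀] with t hgt hrt hWt htI
    have hWt : 2 * g (z t) ∉ L.lattice := hWt
    have hWl : g (z t) ∉ L.lattice := fun h => hWt (two_mul_mem h)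
    have hpz := hrt.self_of_nhds
    refine ⟨by rw [hcoe t htI, sphereMap_of_notMem hWl, hpz], ?_⟩
    obtain ⟨v, hv, ρ, hρ, hvρ⟩ := hzc t htI
    have hW : HasDerivAt (fun s => g (z s)) (deriv g (z t) * v) t :=
      HasDerivAt.comp (h₂ := g) t hgt.differentiableAt.hasDerivAt hv
    have hpW : HasDerivAt (fun s => L.normalizedP (g (z s)))
        (L.derivWeierstrassP (g (z t)) / (L.e₁ - L.e₂) * (deriv g (z t) * v)) t :=
      HasDerivAt.comp (h₂ := L.normalizedP) t (hasDerivAt_normalizedP hWl) hW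
    have hv' := hv.unique (hpW.congr_of_eventuallyEq (hrt.mono fun s hs => hs.symm))
    have hprod := (normalizedP_prod_eq_zero_iff h0 h1 hWl).not.2 hWt
    generalize deriv g (z t) * v = W' at hW hv'
    rw [← hpz, hv', mul_pow, deriv_normalizedP_sq h0 h1 hWl] at hvρ
    -- Horizontality fixes only the square of the lifted velocity, so the sign may depend on the
    -- time. Realness of W'/θ is all that is needed.
    have hsq : (W' / θ) ^ 2 = ((√(ρ / (4 * r)) : ℝ) : ℂ) ^ 2 := by
      have h4 : 4 * (a * (L.e₁ - L.e₂)) * W' ^ 2 = ρ := by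
        rw [← hvρ]
        generalize L.normalizedP (g (z t)) * _ * _ = p at hprod
        field_simp
      rw [← Complex.ofReal_pow, Real.sq_sqrt (by positivity), Complex.ofReal_div, ← h4,
        Complex.ofReal_mul, ← hθ]
      have hr' : a * (L.e₁ - L.e₂) ≠ 0 := mul_ne_zero ha hne
      push_cast
      field_simp
    have hdiv := (hW.sub_const w).div_const θ
    rcases sq_eq_sq_iff_eq_or_eq_neg.1 hsq with h | h
    · exact ⟨√(ρ / (4 * r)), by rwa [h] at hdiv⟩
    · exact ⟨-√(ρ / (4 * r)), by rwa [h, ← Complex.ofReal_neg] at hdiv⟩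
  -- The quotient has real derivative near `t₀` and vanishes at `t₀`; its imaginary part is
  -- therefore constantly 0, and it equals its real part.
  refine ⟨fun t => ((g (z t) - w) / θ).re, by simp [hg],
    Complex.continuous_re.continuousAt.comp ((hWcont.sub continuousAt_const).div_const θ), ?_⟩
  obtain ⟨ε, hε, hball⟩ := Metric.eventually_nhds_iff_ball.1 hlift
  filter_upwards [Metric.ball_mem_nhds t₀ hε] with t ht
  have him : ((g (z t) - w) / θ).im = ((g (z t₀) - w) / θ).im := by
    refine (convex_ball t₀ ε).is_const_of_fderivWithin_eq_zero (𝕜 := ℝ)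
      (f := fun t => ((g (z t) - w) / θ).im) ?_ ?_ ht (Metric.mem_ball_self hε)
    · intro s hs
      obtain ⟨x, hx⟩ := (hball s hs).2
      exact (Complex.imCLM.hasFDerivAt.comp_hasDerivAt s hx).differentiableAt
        |>.differentiableWithinAt
    · intro s hs
      obtain ⟨x, hx⟩ := (hball s hs).2
      have hd : HasDerivAt (fun t => ((g (z t) - w) / θ).im) 0 s := by
        simpa [Function.comp_def] using Complex.imCLM.hasFDerivAt.comp_hasDerivAt s hx
      rw [fderivWithin_of_isOpen Metric.isOpen_ball hs, hd.hasFDerivAt.fderiv]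
      simp
  have hreal : ((((g (z t) - w) / θ).re : ℝ) : ℂ) = (g (z t) - w) / θ := by
    apply Complex.ext <;> simp [him, hg]
  rw [(hball t ht).1, hreal, div_mul_cancel₀ _ hθ0, add_sub_cancel]

/-- Two lifts of a point differ by a translation by a period or by such a translation composed with
w ↦ -w. Both preserve the half periods and the family of lines; the second reverses the parameter.
-/
lemma exists_segment_of_sphereMap_eq (h0 : L.modularLambda ≠ 0) {u v : ℂ} {p : RiemannSphere}
    (huv : L.sphereMap u = L.sphereMap v)
    (h : ∃ s : ℝ, p = L.sphereMap (u + s * θ) ∧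
      ∀ x ∈ Set.uIcc 0 s, 2 * (u + x * θ) ∉ L.lattice) :
    ∃ s : ℝ, p = L.sphereMap (v + s * θ) ∧
      ∀ x ∈ Set.uIcc 0 s, 2 * (v + x * θ) ∉ L.lattice := by
  obtain ⟨s, hs, hs'⟩ := h
  rcases sub_mem_or_add_mem_of_sphereMap_eq h0 huv with h | h
  · refine ⟨s, ?_, fun x hx hm => hs' x hx ?_⟩
    · rw [hs, ← sphereMap_add_mem (v + s * θ) h]; congr 1; ring
    · have := add_mem hm (two_mul_mem h)
      rwa [show 2 * (v + x * θ) + 2 * (u - v) = 2 * (u + x * θ) by ring] at this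
  · refine ⟨-s, ?_, fun x hx hm => hs' (-x) ?_ ?_⟩
    · rw [hs, ← sphereMap_neg (v + _), ← sphereMap_add_mem (-(v + _)) h]
      congr 1; push_cast; ring
    · simp only [Set.mem_uIcc] at hx ⊢
      rcases hx with hx | hx
      · right; constructor <;> linarith
      · left; constructor <;> linarith
    · have := sub_mem (two_mul_mem h) hm
      rwa [show 2 * (u + v) - 2 * (v + x * θ) = 2 * (u + (-x : ℝ) * θ) by push_cast; ring] at this

/-- A horizontal geodesic starting on a straight line of direction `θ` stays on the image of that
line, and does not cross half periods. -/
lemma exists_global_lift (h0 : L.modularLambda ≠ 0) (h1 : L.modularLambda ≠ 1) (ha : a ≠ 0)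
    (hr : 0 < r) (hθ : a * (L.e₁ - L.e₂) * θ ^ 2 = r) {γ : ℝ → RiemannSphere} {I : Set ℝ}
    (hγ : (fourPole L.modularLambda a).IsHorizontalGeodesic γ I) {t₀ t : ℝ} (ht₀ : t₀ ∈ I)
    (ht : t ∈ I) {w : ℂ} (hw : γ t₀ = L.sphereMap w) :
    ∃ s : ℝ, γ t = L.sphereMap (w + s * θ) ∧
      ∀ x ∈ Set.uIcc 0 s, 2 * (w + x * θ) ∉ L.lattice := by
  -- Quantifying over all lifts `w` turns the claim into a symmetric, transitive relation between
  -- times. On a preconnected set it then suffices to prove it locally.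
  refine hγ.ordConnected.isPreconnected.induction₂ (fun t₁ t₂ => ∀ w, γ t₁ = L.sphereMap w →
    ∃ s : ℝ, γ t₂ = L.sphereMap (w + s * θ) ∧
      ∀ x ∈ Set.uIcc 0 s, 2 * (w + x * θ) ∉ L.lattice) ?_ ?_ ?_ ht₀ ht w hw
  · intro t₁ ht₁
    obtain ⟨v, hv⟩ := sphereMap_surjective h0 (γ t₁)
    obtain ⟨σ, hσ, hσc, hσγ⟩ := exists_local_lift h0 h1 ha hr hθ hγ ht₁ hv.symm
    have hv2 : 2 * v ∉ L.lattice := by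
      have := (hγ.horizontal t₁ ht₁).1
      rwa [← hv, isCriticalPoint_sphereMap h0 h1 ha] at this
    have hcont : ContinuousAt (fun x : ℝ => v + x * θ) 0 := by fun_prop
    obtain ⟨ε, hε, hball⟩ := Metric.eventually_nhds_iff_ball.1 (hcont.eventually_mem
      (isClosed_half_lattice.isOpen_compl.mem_nhds (by simpa using hv2)))
    have hsmall : ∀ᶠ t in 𝓝 t₁, σ t ∈ Metric.ball 0 ε :=
      hσc.eventually_mem (by rw [hσ]; exact Metric.ball_mem_nhds 0 hε)
    filter_upwards [nhdsWithin_le_nhds hσγ, nhdsWithin_le_nhds hsmall] with t ht hts w hw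
    exact exists_segment_of_sphereMap_eq h0 (hv.trans hw) ⟨σ t, ht, fun x hx =>
      hball x ((convex_ball (0 : ℝ) ε).ordConnected.uIcc_subset (Metric.mem_ball_self hε) hts hx)⟩
  · intro t₁ t₂ t₃ _ _ _ h12 h23 w hw
    obtain ⟨s, hs, hs'⟩ := h12 w hw
    obtain ⟨s', hs1, hs1'⟩ := h23 _ hs
    refine ⟨s + s', by rw [hs1]; congr 1; push_cast; ring, fun x hx => ?_⟩
    rcases Set.uIcc_subset_uIcc_union_uIcc (b := s) hx with hx | hx
    · exact hs' x hx
    · have := hs1' (x - s) (by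
        simp only [Set.mem_uIcc] at hx ⊢
        rcases hx with hx | hx
        · left; constructor <;> linarith
        · right; constructor <;> linarith)
      convert this using 2
      push_cast; ring
  · intro t₁ t₂ _ _ h12 w hw
    obtain ⟨v, hv⟩ := sphereMap_surjective h0 (γ t₁)
    obtain ⟨s, hs, hs'⟩ := h12 v hv.symm
    refine exists_segment_of_sphereMap_eq h0 (hs.symm.trans hw) ⟨-s, ?_, fun x hx => ?_⟩
    · rw [← hv]; congr 1; push_cast; ring
    · have := hs' (s + x) (by
        simp only [Set.mem_uIcc] at hx ⊢
        rcases hx with hx | hx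
        · right; constructor <;> linarith
        · left; constructor <;> linarith)
      convert this using 2
      push_cast; ring

end PeriodPair

/-! ### Closed, critical and recurrent trajectories -/

namespace PeriodPair

open QuadraticDifferential

variable {L : PeriodPair} {a θ : ℂ} {r : ℝ}

/-- If `θ` is a period, every trajectory is closed or critical. -/
lemma isJenkinsStrebel_of_mem_lattice (h0 : L.modularLambda ≠ 0) (h1 : L.modularLambda ≠ 1)
    (ha : a ≠ 0) (hr : 0 < r) (hθ : a * (L.e₁ - L.e₂) * θ ^ 2 = r) (hmem : θ ∈ L.lattice) :
    (fourPole L.modularLambda a).IsJenkinsStrebel := by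
  rintro T ⟨hT, hnc, hnk⟩
  obtain ⟨γ, I, hγ, rfl⟩ := hT.prop
  obtain ⟨t₀, ht₀⟩ := hγ.nonempty
  obtain ⟨w, hw⟩ := sphereMap_surjective h0 (γ t₀)
  have hlift := fun t ht => exists_global_lift h0 h1 ha hr hθ hγ ht₀ (t := t) ht hw.symm
  have hper : ∀ (x : ℝ) (n : ℤ), 2 * (w + x * θ) ∈ L.lattice →
      2 * (w + ((x + n : ℝ) : ℂ) * θ) ∈ L.lattice := fun x n hx => by
    have := add_mem hx (two_mul_mem (L.lattice.smul_mem n hmem))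
    rw [zsmul_eq_mul] at this
    convert this using 1
    push_cast; ring
  by_cases hline : ∀ x : ℝ, 2 * (w + x * θ) ∉ L.lattice
  · have hg := isHorizontalGeodesic_line h0 h1 ha hr hθ w isOpen_univ Set.ordConnected_univ
      Set.univ_nonempty fun t _ => hline t
    have hsub : γ '' I ⊆ (fun s : ℝ => L.sphereMap (w + s * θ)) '' Set.univ := by
      rintro _ ⟨t, ht, rfl⟩
      obtain ⟨s, hs, -⟩ := hlift t ht
      exact ⟨s, trivial, hs.symm⟩
    refine hnc ⟨_, 1, one_pos, fun s => ?_, hg, ?_⟩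
    · rw [← sphereMap_add_mem (w + s * θ) hmem]
      congr 1; push_cast; ring
    · rw [← Set.image_univ]
      exact hT.eq_of_subset ⟨_, _, hg, rfl⟩ hsub
  · push Not at hline
    obtain ⟨x₀, hx₀⟩ := hline
    set S : Set ℝ := {x : ℝ | 2 * (w + x * θ) ∈ L.lattice} with hS
    have hScl : IsClosed S := isClosed_half_lattice.preimage (f := fun x : ℝ => w + x * θ)
      (by fun_prop)
    have hS0 : (0 : ℝ) ∉ S := by
      obtain ⟨s, -, hs⟩ := hlift t₀ ht₀
      exact hs 0 Set.left_mem_uIcc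
    -- `S` is invariant under integer shifts because θ is a period, so one half period on the line
    -- yields some on both sides of 0. The nearest ones bound the trajectory.
    have hpne : (S ∩ Set.Ici 0).Nonempty :=
      ⟨x₀ + ⌈-x₀⌉, hper _ _ hx₀, by have := Int.le_ceil (-x₀); simp only [Set.mem_Ici]; linarith⟩
    have hnne : (S ∩ Set.Iic 0).Nonempty :=
      ⟨x₀ + ⌊-x₀⌋, hper _ _ hx₀, by have := Int.floor_le (-x₀); simp only [Set.mem_Iic]; linarith⟩
    have hpb : BddBelow (S ∩ Set.Ici 0) := ⟨0, fun x hx => hx.2⟩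
    have hnb : BddAbove (S ∩ Set.Iic 0) := ⟨0, fun x hx => hx.2⟩
    have hp := (hScl.inter isClosed_Ici).csInf_mem hpne hpb
    have hn := (hScl.inter isClosed_Iic).csSup_mem hnne hnb
    set p := sInf (S ∩ Set.Ici 0)
    set n := sSup (S ∩ Set.Iic 0)
    have hp0 : 0 < p := lt_of_le_of_ne hp.2 fun h => hS0 (h ▸ hp.1)
    have hn0 : n < 0 := lt_of_le_of_ne hn.2 fun h => hS0 (h ▸ hn.1)
    have havoid : ∀ x ∈ Set.Ioo n p, x ∉ S := fun x hx hxS => by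
      rcases le_total 0 x with h | h
      · exact (csInf_le hpb ⟨hxS, h⟩).not_gt hx.2
      · exact (le_csSup hnb ⟨hxS, h⟩).not_gt hx.1
    have hg := isHorizontalGeodesic_line h0 h1 ha hr hθ w isOpen_Ioo Set.ordConnected_Ioo
      ⟨0, hn0, hp0⟩ havoid
    have hsub : γ '' I ⊆ (fun s : ℝ => L.sphereMap (w + s * θ)) '' Set.Ioo n p := by
      rintro _ ⟨t, ht, rfl⟩
      obtain ⟨s, hs, hs'⟩ := hlift t ht
      refine ⟨s, ⟨?_, ?_⟩, hs.symm⟩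
      · by_contra! h
        exact hs' n (Set.mem_uIcc.2 (Or.inr ⟨h, hn0.le⟩)) hn.1
      · by_contra! h
        exact hs' p (Set.mem_uIcc.2 (Or.inl ⟨hp0.le, h⟩)) hp.1
    have hcont : Continuous fun s : ℝ => L.sphereMap (w + s * θ) :=
      (continuous_sphereMap h0).comp (by fun_prop)
    exact hnk ⟨_, n, p, _, _, hn0.trans hp0, hg, hT.eq_of_subset ⟨_, _, hg, rfl⟩ hsub,
      (isCriticalPoint_sphereMap h0 h1 ha _).2 hn.1, (isCriticalPoint_sphereMap h0 h1 ha _).2 hp.1,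
      (hcont.tendsto n).mono_left nhdsWithin_le_nhds,
      (hcont.tendsto p).mono_left nhdsWithin_le_nhds⟩

/-- Multiples of a complex number return arbitrarily close to a lattice. -/
lemma frequently_mul_sub_mem (L : PeriodPair) (θ : ℂ) {U : Set ℂ} (hU : U ∈ 𝓝 (0 : ℂ)) :
    ∃ᶠ n : ℕ in atTop, ∃ l ∈ L.lattice, n * θ - l ∈ U := by
  obtain ⟨ε, hε, hball⟩ := Metric.mem_nhds_iff.1 hU
  let x : ℕ → ℂ := fun n => ZSpan.fract L.basis (n * θ)
  obtain ⟨y, -, φ, hφ, hy⟩ := tendsto_subseq_of_bounded (x := x)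
    (Metric.isBounded_closedBall (x := (0 : ℂ)) (r := ∑ i, ‖L.basis i‖))
    (fun n => by simpa using ZSpan.norm_fract_le L.basis _)
  have hc := hy.cauchySeq
  obtain ⟨N, hN⟩ := Metric.cauchySeq_iff.1 hc ε hε
  rw [frequently_atTop]
  intro K
  -- Two close terms of the convergent subsequence of fractional parts are subtracted. The later
  -- index is taken this large so that the difference of multiples is at least `K`.
  have hle : φ N + K ≤ φ (φ N + K + N) := (Nat.le_add_right _ N).trans (hφ.id_le _)
  refine ⟨φ (φ N + K + N) - φ N, by omega,
    ZSpan.floor L.basis (φ (φ N + K + N) * θ) - ZSpan.floor L.basis (φ N * θ), ?_, hball ?_⟩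
  · rw [L.lattice_eq_span_range_basis]
    exact sub_mem (Subtype.coe_prop _) (Subtype.coe_prop _)
  · rw [mem_ball_zero_iff]
    have := hN (φ N + K + N) (by omega) N le_rfl
    simp only [dist_eq_norm, x, Function.comp, ZSpan.fract_apply] at this
    refine lt_of_eq_of_lt (congrArg norm ?_) this
    rw [Nat.cast_sub (by omega)]
    ring

/-- If no real multiple of `θ` is a nonzero period, there is a recurrent trajectory. -/
lemma not_isJenkinsStrebel (h0 : L.modularLambda ≠ 0) (h1 : L.modularLambda ≠ 1)
    (ha : a ≠ 0) (hr : 0 < r) (hθ : a * (L.e₁ - L.e₂) * θ ^ 2 = r)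
    (hirr : ∀ x : ℝ, x * θ ∈ L.lattice → x = 0) :
    ¬ (fourPole L.modularLambda a).IsJenkinsStrebel := by
  have hθ0 : θ ≠ 0 := by
    rintro rfl
    exact hr.ne' (by simpa using hθ.symm)
  -- Lines of direction θ form an uncountable family indexed by a transverse coordinate, and only
  -- countably many of them meet the half periods.
  obtain ⟨w, hline⟩ : ∃ w : ℂ, ∀ x : ℝ, 2 * (w + x * θ) ∉ L.lattice := by
    have hcount : ((fun l : ℂ => (l / (2 * θ)).im) '' (L.lattice : Set ℂ)).Countable :=
      L.countable_lattice.image _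
    obtain ⟨y, hy⟩ := (hcount.dense_compl ℝ).nonempty
    refine ⟨y * Complex.I * θ, fun x hx => hy ⟨_, hx, ?_⟩⟩
    have : 2 * (y * Complex.I * θ + x * θ) / (2 * θ) = x + y * Complex.I := by
      field_simp; ring
    simp [this]
  have hinj : ∀ s t : ℝ, L.sphereMap (w + s * θ) = L.sphereMap (w + t * θ) → s = t := by
    intro s t h
    rcases sub_mem_or_add_mem_of_sphereMap_eq h0 h with h | h
    · have := hirr (s - t) (by convert h using 1; push_cast; ring)
      linarith
    -- If the two points agree up to sign modulo the lattice, their midpoint is a half period on the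
    -- line.
    · refine absurd ?_ (hline ((s + t) / 2))
      convert h using 1; push_cast; ring
  have hg := isHorizontalGeodesic_line h0 h1 ha hr hθ w isOpen_univ Set.ordConnected_univ
    Set.univ_nonempty fun t _ => hline t
  set T := (fun s : ℝ => L.sphereMap (w + s * θ)) '' Set.univ
  have htraj : (fourPole L.modularLambda a).IsTrajectory T := by
    refine ⟨⟨_, _, hg, rfl⟩, ?_⟩
    rintro _ ⟨γ, I, hγ, rfl⟩ hle
    obtain ⟨t₀, ht₀, ht₀'⟩ := hle ⟨0, trivial, rfl⟩
    rintro _ ⟨t, ht, rfl⟩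
    obtain ⟨s, hs, -⟩ := exists_global_lift h0 h1 ha hr hθ hγ ht₀ ht ht₀'
    exact ⟨s + (0 : ℝ), trivial, by rw [hs]; simp only; congr 1; push_cast; ring⟩
  -- every parametrization of `T` lifts to a continuous parameter on the line
  have hparam : ∀ (γ : ℝ → RiemannSphere) (I : Set ℝ),
      (fourPole L.modularLambda a).IsHorizontalGeodesic γ I → T = γ '' I →
      ∃ s : ℝ → ℝ, ContinuousOn s I ∧ (∀ t ∈ I, γ t = L.sphereMap (w + s t * θ)) ∧
        ∀ x, ∃ t ∈ I, s t = x := by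
    intro γ I hγ hTγ
    have hex : ∀ t, ∃ s : ℝ, t ∈ I → γ t = L.sphereMap (w + s * θ) := fun t => by
      by_cases ht : t ∈ I
      · obtain ⟨s, -, hs⟩ := hTγ.symm ▸ Set.mem_image_of_mem γ ht
        exact ⟨s, fun _ => hs.symm⟩
      · exact ⟨0, fun h => absurd h ht⟩
    choose s hs using hex
    refine ⟨s, fun t ht => ?_, hs, fun x => ?_⟩
    · obtain ⟨σ, hσ, hσc, hσγ⟩ := exists_local_lift h0 h1 ha hr hθ hγ ht (hs t ht)
      have hc : ContinuousAt (fun t' => s t + σ t') t := continuousAt_const.add hσc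
      refine (hc.congr ?_).continuousWithinAt
      filter_upwards [hσγ, hγ.isOpen.mem_nhds ht] with t' h h'
      refine hinj _ _ ?_
      rw [← hs t' h', h]
      congr 1; push_cast; ring
    · have : L.sphereMap (w + x * θ) ∈ γ '' I := hTγ ▸ ⟨x, trivial, rfl⟩
      obtain ⟨t, ht, htx⟩ := this
      exact ⟨t, ht, hinj _ _ ((hs t ht).symm.trans htx)⟩
  refine fun hJS => hJS T ⟨htraj, ?_, ?_⟩
  · rintro ⟨γ, ℓ, hℓ, hper, hγ, hTγ⟩
    obtain ⟨s, hsc, hs, hsurj⟩ := hparam γ Set.univ hγ (by rw [hTγ, Set.image_univ])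
    -- One period covers the whole trajectory, so the line parameter would be bounded, yet it takes
    -- every real value.
    obtain ⟨M, hM⟩ := (isCompact_Icc (a := (0 : ℝ)) (b := ℓ)).bddAbove_image
      (hsc.mono (Set.subset_univ _))
    obtain ⟨t, -, ht⟩ := hsurj (M + 1)
    obtain ⟨t', ht', htt⟩ := hper.exists_mem_Ico₀ hℓ t
    have : s t' = s t := hinj _ _ (by rw [← hs _ trivial, ← hs _ trivial, htt])
    have := hM ⟨t', Set.Ico_subset_Icc_self ht', rfl⟩
    linarith
  · rintro ⟨γ, b, c, p, q, hbc, hγ, hTγ, hp, hq, hbp, hcq⟩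
    obtain ⟨s, hsc, hs, hsurj⟩ := hparam γ _ hγ hTγ
    have hw0 : ¬ (fourPole L.modularLambda a).IsCriticalPoint (L.sphereMap w) := by
      rw [isCriticalPoint_sphereMap h0 h1 ha]
      simpa using hline 0
    -- Near both ends the curve stays in `V`, away from the image of `w`, and on the compact middle
    -- part the line parameter is at most some `M`. A return of the line to `U` at an integer time
    -- beyond `M` contradicts this.
    have hd : Disjoint (𝓝 (L.sphereMap w)) (𝓝 p ⊔ 𝓝 q) :=
      disjoint_sup_right.2 ⟨disjoint_nhds_nhds.2 fun h => hw0 (h ▸ hp),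
        disjoint_nhds_nhds.2 fun h => hw0 (h ▸ hq)⟩
    obtain ⟨U, hU, V, hV, hUV⟩ := Filter.disjoint_iff.1 hd
    obtain ⟨b', hb', hbV⟩ := (mem_nhdsGT_iff_exists_Ioo_subset' hbc).1 (hbp hV.1)
    obtain ⟨c', hc', hcV⟩ := (mem_nhdsLT_iff_exists_Ioo_subset' hbc).1 (hcq hV.2)
    obtain ⟨M, hM⟩ := (isCompact_Icc (a := b') (b := c')).bddAbove_image
      (hsc.mono (Set.Icc_subset_Ioo hb' hc'))
    have hU' : {z : ℂ | L.sphereMap (w + z) ∈ U} ∈ 𝓝 (0 : ℂ) := by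
      have : ContinuousAt (fun z => L.sphereMap (w + z)) 0 :=
        ((continuous_sphereMap h0).comp (continuous_const_add w)).continuousAt
      exact this.eventually_mem (by simpa using hU)
    obtain ⟨n, ⟨l, hl, hn⟩, hnM⟩ := ((frequently_mul_sub_mem L θ hU').and_eventually
      (tendsto_natCast_atTop_atTop.eventually_gt_atTop M)).exists
    obtain ⟨t, ht, htn⟩ := hsurj n
    have hγU : γ t ∈ U := by
      rw [hs t ht, htn, ← sphereMap_add_mem _ (neg_mem hl)]
      have hn' : L.sphereMap (w + (n * θ - l)) ∈ U := hn
      convert hn' using 2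
      push_cast; ring
    have hγV : γ t ∈ V := by
      by_cases h1 : t < b'
      · exact hbV ⟨ht.1, h1⟩
      by_cases h2 : c' < t
      · exact hcV ⟨h2, ht.2⟩
      · have := hM ⟨t, ⟨not_lt.1 h1, not_lt.1 h2⟩, rfl⟩
        rw [htn] at this
        exact absurd this (not_le.2 hnM)
    exact hUV.le_bot ⟨hγU, hγV⟩

/-! ### The lattice criterion and its form in the basis 1, τ -/

theorem isJenkinsStrebel_iff (h0 : L.modularLambda ≠ 0) (h1 : L.modularLambda ≠ 1) (ha : a ≠ 0) :
    (fourPole L.modularLambda a).IsJenkinsStrebel ↔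
      ∃ v ∈ L.lattice, ∃ k : ℝ, 0 < k ∧ a * (L.e₁ - L.e₂) * v ^ 2 = k := by
  have hne := mul_ne_zero ha (e₁_ne_e₂ h0)
  constructor
  · intro hJS
    by_contra! hno
    -- This θ is a horizontal direction; a nonzero real multiple of it in the lattice would be an
    -- excluded period.
    obtain ⟨θ, hθ⟩ := IsAlgClosed.exists_pow_nat_eq (a * (L.e₁ - L.e₂))⁻¹ two_pos
    have hθ' : a * (L.e₁ - L.e₂) * θ ^ 2 = (1 : ℝ) := by
      rw [hθ, mul_inv_cancel₀ hne, Complex.ofReal_one]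
    refine not_isJenkinsStrebel h0 h1 ha one_pos hθ' (fun x hx => ?_) hJS
    by_contra hx0
    refine hno _ hx (x ^ 2) (by positivity) ?_
    rw [mul_pow]
    rw [Complex.ofReal_one] at hθ'
    push_cast
    linear_combination (x : ℂ) ^ 2 * hθ'
  · rintro ⟨v, hv, k, hk, h⟩
    exact isJenkinsStrebel_of_mem_lattice h0 h1 ha hk h hv

lemma mem_lattice_iff_of_basis_one {τ : ℂ}
    (hL : (L.ω₁ = τ ∧ L.ω₂ = 1) ∨ (L.ω₁ = 1 ∧ L.ω₂ = τ)) {v : ℂ} :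
    v ∈ L.lattice ↔ ∃ m n : ℤ, (m : ℂ) + n * τ = v := by
  rw [mem_lattice]
  rcases hL with ⟨h1, h2⟩ | ⟨h1, h2⟩ <;> rw [h1, h2]
  · rw [exists_comm]
    simp only [mul_one, add_comm]
  · simp only [mul_one]

end PeriodPair

/-- Here `L` is the lattice spanned by `1` and `τ` with either ordering of this basis, so both
conventions `τ = ω₁ / ω₂` and `τ = ω₂ / ω₁` for the argument of `λ` are covered. -/
theorem mainTheorem1 (μ : ℂ) (hμ0 : μ ≠ 0) (hμ1 : μ ≠ 1)
    (τ : ℂ) (L : PeriodPair)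
    (hL : (L.ω₁ = τ ∧ L.ω₂ = 1) ∨ (L.ω₁ = 1 ∧ L.ω₂ = τ))
    (hlambda : L.modularLambda = μ)
    (a : ℂ) (ha : a ≠ 0) :
    (QuadraticDifferential.fourPole μ a).IsJenkinsStrebel ↔
      (∃ (q : ℚ) (k : ℝ), 0 < k ∧ a = (k : ℂ) / ((1 + (q : ℂ) * τ) ^ 2 * (L.e₁ - L.e₂))) ∨
      (∃ k : ℝ, 0 < k ∧ a = (k : ℂ) / (τ ^ 2 * (L.e₁ - L.e₂))) := by
  subst hlambda
  have hne := PeriodPair.e₁_ne_e₂ hμ0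
  rw [PeriodPair.isJenkinsStrebel_iff hμ0 hμ1 ha]
  constructor
  · rintro ⟨v, hv, k, hk, h⟩
    obtain ⟨m, n, rfl⟩ := (PeriodPair.mem_lattice_iff_of_basis_one hL).1 hv
    have hv0 : (m : ℂ) + n * τ ≠ 0 := by
      intro h0
      rw [h0] at h
      exact hk.ne' (by simpa using h.symm)
    rcases eq_or_ne m 0 with rfl | hm
    · right
      have hnτ : (n : ℂ) ≠ 0 ∧ τ ≠ 0 := by simpa using hv0
      have hn : (n : ℝ) ≠ 0 := by exact_mod_cast hnτ.1
      refine ⟨k / n ^ 2, by positivity, ?_⟩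
      obtain ⟨hn', hτ⟩ := hnτ
      push_cast
      rw [← h]
      field_simp
      push_cast
      ring
    · left
      have hm' : (m : ℂ) ≠ 0 := by exact_mod_cast hm
      have hmr : (m : ℝ) ≠ 0 := by exact_mod_cast hm
      refine ⟨n / m, k / m ^ 2, by positivity, ?_⟩
      have h1 : 1 + ((n / m : ℚ) : ℂ) * τ = (m + n * τ) / m := by
        push_cast; field_simp
      rw [h1]
      push_cast
      rw [← h]
      field_simp
  · rintro (⟨q, k, hk, rfl⟩ | ⟨k, hk, rfl⟩)
    · have hq : 1 + (q : ℂ) * τ ≠ 0 := fun h => ha (by simp [h])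
      -- Clearing the denominator of q turns 1 + qτ into a period and multiplies k by the square of
      -- the denominator.
      refine ⟨q.den + q.num * τ, (PeriodPair.mem_lattice_iff_of_basis_one hL).2
        ⟨q.den, q.num, by push_cast; rfl⟩, k * q.den ^ 2, by positivity, ?_⟩
      have hden : (q.den : ℂ) ≠ 0 := by exact_mod_cast q.den_nz
      have h1 : (q.den : ℂ) + q.num * τ = q.den * (1 + q * τ) := by
        rw [Rat.cast_def q]; field_simp
      rw [h1]
      push_cast
      field_simp
    · have hτ : τ ≠ 0 := fun h => ha (by simp [h])
      refine ⟨τ, (PeriodPair.mem_lattice_iff_of_basis_one hL).2 ⟨0, 1, by simp⟩, k, hk, ?_⟩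
      field_simp
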